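/- Let $\mathbb{H}=\{z\in\mathbb{C}:\operatorname{Im} z>0\}$, let $0\le a<b\le\pi$ with $[a,b]\ne[0,\pi]$, and put $\theta=\frac{b-a}{2}\in(0,\pi/2)$, $\xi=e^{i(a+\theta)}$ and $\Delta(\theta)=1/\sqrt{4+\tan^2\theta}$. Let $(a_k),(\gamma_k),(\epsilon_k),(\theta_k)$, $k\ge 1$, be real sequences such that, for all $k\ge1$, $$a_k>0,\quad \gamma_k>0,\quad \epsilon_k>0,\quad \pi\epsilon_k\le\theta,\quad \lim_{j\to\infty}\epsilon_j=0,$$ $$\theta_{2k}+\pi\epsilon_{2k}=\theta,\qquad \theta_{2k-1}-\pi\epsilon_{2k-1}=-\theta,$$ $$\sum_{l=1}^\infty \frac{a_l}{\gamma_l^{\epsilon_l}}\le\frac{\gamma_1}{2},\qquad \gamma_1\ge2,\qquad \gamma_{k+1}>\gamma_k^2,$$ $$\sum_{l=1}^{k-1}\frac{a_l}{\gamma_k^{\epsilon_l}}\le\frac{\Delta(\theta)a_k}{2k\,\gamma_k^{2\epsilon_k}},\qquad \sum_{l=k+1}^\infty\frac{a_l}{\gamma_l^{\epsilon_l}}\le\frac{\Delta(\theta)a_k}{2k\,\gamma_k^{2\epsilon_k}}.$$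 For $z\in\mathbb{C}\setminus(-\infty,0]$ put $$F(z)=z+\sum_{k=1}^\infty\frac{a_ke^{i\theta_k}}{(z+\gamma_k)^{\epsilon_k}}$$ (principal branch of the powers), and let $f(z)=\xi F(\overline{\xi}z)$ for $z\in\mathbb{H}$. Suppose that $\beta\in\mathbb{R}$ and a finite positive Borel measure $\mu$ on $\mathbb{R}$ represent $f$, that is, $$f(z)=z+\beta+\int_{\mathbb{R}}\frac{1+tz}{t-z}\,d\mu(t),\qquad z\in\mathbb{H}.$$ Then: 1. $\mu$ is absolutely continuous with respect to Lebesgue measure on $\mathbb{R}$. More precisely, with $v(z)=\operatorname{Im}(f(z)-z)$, the limit $v^*(x)=\lim_{y\to0^+}v(x+iy)\in[0,+\infty)$ exists for every $x\in\mathbb{R}$, and $d\mu(t)=\dfrac{v^*(t)}{\pi(1+t^2)}\,dt$. 2. If $$\sum_{k=1}^\infty\frac{a_k\log(1+\gamma_k^2)}{\gamma_k^{\epsilon_k}}<+\infty\quad\text{and}\quad\sum_{k=1}^\infty\frac{a_k}{\epsilon_k\gamma_k^{\epsilon_k}}<+\infty,$$ then $\int_{\mathbb{R}}|t|\,d\mu(t)<+\infty$.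 3. If $\int_{\mathbb{R}}|t|\,d\mu(t)<+\infty$ (in particular under the assumptions of 2), then $\beta=\int_{\mathbb{R}}t\,d\mu(t)$. -/

import Mathlib

open MeasureTheory Filter Topology

noncomputable section

namespace SlopeExample

/-- Four real sequences `a_k`, `γ_k`, `ε_k`, `θ_k`, used for `k ≥ 1` only (the value at index `0`
plays no role). -/
structure Coefficients where
  a : ℕ → ℝ
  γ : ℕ → ℝ
  ε : ℕ → ℝ
  ang : ℕ → ℝ

/-- `Δ(θ) = 1 / √(4 + tan² θ)`. -/
def Delta (θ : ℝ) : ℝ := 1 / Real.sqrt (4 + Real.tan θ ^ 2)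

/-- The standing assumptions on the coefficients, for a given opening `θ`.
The series over `l ≥ 1` (resp. `l ≥ k + 1`) is written as a series over `n : ℕ` with
`l = n + 1` (resp. `l = k + 1 + n`). -/
structure Coefficients.Admissible (c : Coefficients) (θ : ℝ) : Prop where
  a_pos : ∀ k, 1 ≤ k → 0 < c.a k
  γ_pos : ∀ k, 1 ≤ k → 0 < c.γ k
  ε_pos : ∀ k, 1 ≤ k → 0 < c.ε k
  ε_le : ∀ k, 1 ≤ k → Real.pi * c.ε k ≤ θ
  ε_tendsto : Tendsto c.ε atTop (𝓝 0)
  ang_even : ∀ k, 1 ≤ k → c.ang (2 * k) + Real.pi * c.ε (2 * k) = θ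
  ang_odd : ∀ k, 1 ≤ k → c.ang (2 * k - 1) - Real.pi * c.ε (2 * k - 1) = -θ
  step_summable : Summable fun n : ℕ => c.a (n + 1) / c.γ (n + 1) ^ c.ε (n + 1)
  step_le : ∑' n : ℕ, c.a (n + 1) / c.γ (n + 1) ^ c.ε (n + 1) ≤ c.γ 1 / 2
  γ_one : 2 ≤ c.γ 1
  γ_growth : ∀ k, 1 ≤ k → c.γ k ^ 2 < c.γ (k + 1)
  head_le : ∀ k, 1 ≤ k →
    ∑ l ∈ Finset.Ico 1 k, c.a l / c.γ k ^ c.ε l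
      ≤ Delta θ * c.a k / (2 * (k : ℝ) * c.γ k ^ (2 * c.ε k))
  tail_le : ∀ k, 1 ≤ k →
    ∑' n : ℕ, c.a (k + 1 + n) / c.γ (k + 1 + n) ^ c.ε (k + 1 + n)
      ≤ Delta θ * c.a k / (2 * (k : ℝ) * c.γ k ^ (2 * c.ε k))

/-- `p_k(z) = a_k e^{iθ_k} / (z + γ_k)^{ε_k}`, with the principal branch of the power. -/
def Coefficients.pTerm (c : Coefficients) (k : ℕ) (z : ℂ) : ℂ :=
  (c.a k : ℂ) * Complex.exp (Complex.I * (c.ang k : ℂ)) / (z + (c.γ k : ℂ)) ^ (c.ε k : ℂ)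

/-- `p(z) = ∑_{k ≥ 1} p_k(z)`. -/
def Coefficients.p (c : Coefficients) (z : ℂ) : ℂ := ∑' n : ℕ, c.pTerm (n + 1) z

/-- `F(z) = z + p(z)`. -/
def Coefficients.F (c : Coefficients) (z : ℂ) : ℂ := z + c.p z

/-- The opening `θ = (b - a) / 2` attached to the interval `[a, b]`. -/
def opening (a b : ℝ) : ℝ := (b - a) / 2

/-- The rotation `ξ = e^{i(a + θ)}` with `θ = (b - a) / 2`. -/
def rot (a b : ℝ) : ℂ := Complex.exp (Complex.I * ((a + opening a b : ℝ) : ℂ))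

/-- The self-map `f(z) = ξ F(ξ̄ z)` of the upper half-plane; only its values at points with
positive imaginary part are used. -/
def Coefficients.f (c : Coefficients) (a b : ℝ) (z : ℂ) : ℂ :=
  rot a b * c.F ((starRingEnd ℂ) (rot a b) * z)

/-- `f` is represented on the upper half-plane by the pair `(β, μ)`:
`f(z) = z + β + ∫ (1 + t z) / (t - z) dμ(t)`. -/
def IsRepresentedBy (f : ℂ → ℂ) (β : ℝ) (μ : Measure ℝ) : Prop :=
  ∀ z : ℂ, 0 < z.im →
    f z = z + (β : ℂ) + ∫ t : ℝ, (1 + (t : ℂ) * z) / ((t : ℂ) - z) ∂μ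

end SlopeExample

end

/-! Since `ξ` has modulus one, `f(z) - z = ξ p(ξ̄ z)`. The argument `(a + b) / 2` of `ξ` lies in
`(0, π)`, so `Im ξ > 0` and the points `-γ_k ξ` lie below the real axis. Hence on the closed upper
half-plane each term of `p(ξ̄ z)` is bounded by `a_k / γ_k ^ ε_k` up to the factor `1 / Im ξ`. The
series therefore converges uniformly there, is continuous up to the real line
(`continuousOn_p_rot`), and tends to `0` along `iy` (`tendsto_p_rot`).

By the representation, `v = Im (f(z) - z)` is the Poisson integral of `(1 + t²) dμ`. Continuous
boundary values exclude a singular part, and Stieltjes inversion gives the density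
(`eq_withDensity_of_poisson`).

For the moment, a bound decaying in `|x|` on the real line (`norm_pTerm_real_le`) is integrated
against `|t| / (1 + t²)` term by term; each term is controlled by the corresponding terms of the two
assumed series (`lintegral_weight_le`). Finally, letting `z = iy → i∞` in the representation, where
the kernel tends to `-t`, identifies `β` (`eq_integral_of_tendsto`). -/

namespace SlopeExample

/-! ### Poisson integrals and Stieltjes inversion -/

/-- The imaginary part of the kernel `(1 + t z) / (t - z)` at `z = x + i y`. -/
noncomputable def poissonKernel (y x t : ℝ) : ℝ := y * (1 + t ^ 2) / ((t - x) ^ 2 + y ^ 2)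

lemma im_kernel (t : ℝ) (z : ℂ) :
    ((1 + (t : ℂ) * z) / ((t : ℂ) - z)).im = poissonKernel z.im z.re t := by
  have h : Complex.normSq ((t : ℂ) - z) = (t - z.re) ^ 2 + z.im ^ 2 := by
    simp [Complex.normSq_apply]; ring
  rw [Complex.div_im, h, poissonKernel]
  simp
  ring

lemma poissonKernel_nonneg {y : ℝ} (hy : 0 ≤ y) (x t : ℝ) : 0 ≤ poissonKernel y x t := by
  unfold poissonKernel; positivity

/-- Follows from `t² ≤ 2 x² + 2 (t - x)²`, whose defect is `(t - 2x)²`. -/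
lemma poissonKernel_le {y : ℝ} (hy : 0 < y) (x t : ℝ) :
    poissonKernel y x t ≤ (1 + 2 * x ^ 2) * (y / ((t - x) ^ 2 + y ^ 2)) + 2 * y := by
  have hp : 0 < (t - x) ^ 2 + y ^ 2 := by positivity
  unfold poissonKernel
  rw [div_le_iff₀ hp, add_mul, mul_assoc, div_mul_cancel₀ _ hp.ne']
  nlinarith [mul_nonneg hy.le (sq_nonneg (t - 2 * x)), pow_pos hy 3]

lemma continuous_poissonKernel {y : ℝ} (hy : 0 < y) :
    Continuous fun q : ℝ × ℝ => poissonKernel y q.1 q.2 := by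
  unfold poissonKernel
  refine Continuous.div (by fun_prop) (by fun_prop) fun q => ?_
  positivity

lemma integral_cauchyKernel {y : ℝ} (hy : 0 < y) (c d t : ℝ) :
    ∫ x in c..d, y / ((t - x) ^ 2 + y ^ 2) =
      Real.arctan ((d - t) / y) - Real.arctan ((c - t) / y) := by
  refine intervalIntegral.integral_eq_sub_of_hasDerivAt
    (f := fun x => Real.arctan ((x - t) / y)) (fun x _ => ?_) ?_
  · have h := (((hasDerivAt_id x).sub_const t).div_const y).arctan
    refine h.congr_deriv ?_
    simp only [id]
    field_simp
    ring
  · refine (Continuous.div (by fun_prop) (by fun_prop) fun x => ?_).intervalIntegrable _ _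
    positivity

lemma integral_poissonKernel {y : ℝ} (hy : 0 < y) (c d t : ℝ) :
    ∫ x in c..d, poissonKernel y x t =
      (1 + t ^ 2) * (Real.arctan ((d - t) / y) - Real.arctan ((c - t) / y)) := by
  rw [← integral_cauchyKernel hy, ← intervalIntegral.integral_const_mul]
  refine intervalIntegral.integral_congr fun x _ => ?_
  simp only [poissonKernel]; ring

/-- The bound is uniform in `t` and in `y ∈ (0, 1]`: despite the weight `1 + t²`, a constant
dominates the passage `y → 0+`. -/
lemma integral_poissonKernel_le {y : ℝ} (hy : 0 < y) (hy1 : y ≤ 1) {c d R : ℝ} (hcd : c ≤ d)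
    (hR : ∀ x ∈ Set.Icc c d, x ^ 2 ≤ R) (t : ℝ) :
    ∫ x in c..d, poissonKernel y x t ≤ (1 + 2 * R) * Real.pi + 2 * (d - c) := by
  have hR0 : 0 ≤ R := (sq_nonneg c).trans (hR c ⟨le_rfl, hcd⟩)
  have hc : Continuous fun x => y / ((t - x) ^ 2 + y ^ 2) :=
    Continuous.div (by fun_prop) (by fun_prop) fun x => by positivity
  have hk : Continuous fun x => poissonKernel y x t :=
    (continuous_poissonKernel hy).comp (by fun_prop : Continuous fun x : ℝ => (x, t))
  have h1 : ∫ x in c..d, poissonKernel y x t ≤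
      ∫ x in c..d, ((1 + 2 * R) * (y / ((t - x) ^ 2 + y ^ 2)) + 2) := by
    refine intervalIntegral.integral_mono_on hcd (hk.intervalIntegrable _ _)
      (((continuous_const.mul hc).add continuous_const).intervalIntegrable _ _) fun x hx => ?_
    refine (poissonKernel_le hy x t).trans ?_
    have := hR x hx
    gcongr
    linarith
  refine h1.trans ?_
  have hc' : Continuous fun x => (1 + 2 * R) * (y / ((t - x) ^ 2 + y ^ 2)) := continuous_const.mul hc
  rw [intervalIntegral.integral_add (hc'.intervalIntegrable _ _)
    (continuous_const.intervalIntegrable _ _), intervalIntegral.integral_const_mul,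
    integral_cauchyKernel hy, intervalIntegral.integral_const, smul_eq_mul]
  have := Real.arctan_lt_pi_div_two ((d - t) / y)
  have := Real.neg_pi_div_two_lt_arctan ((c - t) / y)
  have : (1 + 2 * R) * (Real.arctan ((d - t) / y) - Real.arctan ((c - t) / y)) ≤
      (1 + 2 * R) * Real.pi := by gcongr; linarith
  linarith

/-- The limit of `arctan (s / y)` as `y → 0+`. -/
noncomputable def arctanLimit (s : ℝ) : ℝ :=
  if 0 < s then Real.pi / 2 else if s = 0 then 0 else -(Real.pi / 2)

lemma tendsto_arctan_div (s : ℝ) :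
    Tendsto (fun y : ℝ => Real.arctan (s / y)) (𝓝[>] 0) (𝓝 (arctanLimit s)) := by
  rcases lt_trichotomy s 0 with h | h | h
  · have e : arctanLimit s = -(Real.pi / 2) := by
      simp [arctanLimit, not_lt.mpr h.le, h.ne]
    rw [e]
    refine (Real.tendsto_arctan_atBot.mono_right nhdsWithin_le_nhds).comp ?_
    exact (tendsto_inv_nhdsGT_zero.const_mul_atTop_of_neg h).congr fun y =>
      (div_eq_mul_inv s y).symm
  · simp [arctanLimit, h]
  · have e : arctanLimit s = Real.pi / 2 := by simp [arctanLimit, h]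
    rw [e]
    refine (Real.tendsto_arctan_atTop.mono_right nhdsWithin_le_nhds).comp ?_
    exact (tendsto_inv_nhdsGT_zero.const_mul_atTop h).congr fun y =>
      (div_eq_mul_inv s y).symm

lemma tendsto_integral_poissonKernel (c d t : ℝ) :
    Tendsto (fun y : ℝ => ∫ x in c..d, poissonKernel y x t) (𝓝[>] 0)
      (𝓝 ((1 + t ^ 2) * (arctanLimit (d - t) - arctanLimit (c - t)))) := by
  refine (((tendsto_arctan_div (d - t)).sub (tendsto_arctan_div (c - t))).const_mul _).congr' ?_
  filter_upwards [self_mem_nhdsWithin] with y hy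
  exact (integral_poissonKernel hy c d t).symm

lemma measurable_arctanLimit : Measurable arctanLimit :=
  Measurable.ite measurableSet_Ioi measurable_const
    (Measurable.ite (measurableSet_singleton 0) measurable_const measurable_const)

lemma exists_sq_le (c d : ℝ) : ∃ R : ℝ, ∀ x ∈ Set.Icc c d, x ^ 2 ≤ R := by
  obtain ⟨R, hR⟩ := (isCompact_Icc (a := c) (b := d)).bddAbove_image
    (f := fun x : ℝ => x ^ 2) (by fun_prop)
  exact ⟨R, fun x hx => hR ⟨x, hx, rfl⟩⟩

lemma integral_integral_poissonKernel (μ : Measure ℝ) [IsFiniteMeasure μ] {y : ℝ} (hy : 0 < y)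
    {c d : ℝ} (hcd : c ≤ d) :
    ∫ x in c..d, ∫ t, poissonKernel y x t ∂μ = ∫ t, (∫ x in c..d, poissonKernel y x t) ∂μ := by
  simp only [intervalIntegral.integral_of_le hcd]
  refine integral_integral_swap ?_
  obtain ⟨R, hR⟩ := exists_sq_le c d
  have hm : AEStronglyMeasurable (fun q : ℝ × ℝ => poissonKernel y q.1 q.2)
      ((volume.restrict (Set.Ioc c d)).prod μ) :=
    (continuous_poissonKernel hy).aestronglyMeasurable
  refine Integrable.of_bound hm ((1 + 2 * R) * (1 / y) + 2 * y) ?_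
  have : ∀ᵐ q ∂((volume.restrict (Set.Ioc c d)).prod μ), q.1 ∈ Set.Ioc c d :=
    Measure.quasiMeasurePreserving_fst.ae (ae_restrict_mem measurableSet_Ioc)
  filter_upwards [this] with q hq
  have hq2 := hR q.1 (Set.Ioc_subset_Icc_self hq)
  have hR0 : 0 ≤ R := (sq_nonneg _).trans hq2
  simp only [Function.uncurry]
  rw [Real.norm_of_nonneg (poissonKernel_nonneg hy.le _ _)]
  refine (poissonKernel_le hy _ _).trans ?_
  have h1 : y / ((q.2 - q.1) ^ 2 + y ^ 2) ≤ 1 / y := by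
    rw [div_le_div_iff₀ (by positivity) hy]
    nlinarith [sq_nonneg (q.2 - q.1)]
  gcongr

lemma boundary_nonneg {μ : Measure ℝ} {v : ℂ → ℝ} (hv : ContinuousOn v {z | 0 ≤ z.im})
    (hμ : ∀ z : ℂ, 0 < z.im → v z = ∫ t, poissonKernel z.im z.re t ∂μ) (z : ℂ) (hz : 0 ≤ z.im) :
    0 ≤ v z ∧
      Tendsto (fun y : ℝ => v (z + (y : ℂ) * Complex.I)) (𝓝[>] 0) (𝓝 (v z)) := by
  have ht : Tendsto (fun y : ℝ => v (z + (y : ℂ) * Complex.I)) (𝓝[>] 0) (𝓝 (v z)) := by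
    refine Tendsto.comp (hv z hz) (tendsto_nhdsWithin_iff.mpr ⟨?_, ?_⟩)
    · have hc : Continuous fun y : ℝ => z + (y : ℂ) * Complex.I := by fun_prop
      simpa using (hc.tendsto 0).mono_left (nhdsWithin_le_nhds (s := Set.Ioi 0))
    · filter_upwards [self_mem_nhdsWithin] with y hy
      have : 0 < y := hy
      simp only [Complex.add_im, Complex.mul_im, Complex.ofReal_re,
        Complex.I_im, mul_one, Complex.ofReal_im, Complex.I_re, mul_zero, add_zero]
      linarith
  refine ⟨ge_of_tendsto ht ?_, ht⟩
  filter_upwards [self_mem_nhdsWithin] with y hy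
  have : 0 < y := hy
  rw [hμ _ (by simp; linarith)]
  refine integral_nonneg fun t => poissonKernel_nonneg ?_ _ _
  simp; linarith

section Inversion

variable {μ : Measure ℝ} [IsFiniteMeasure μ] {v : ℂ → ℝ}

/-- Integrate `v(x + iy)` over `[c, d]`, apply Fubini, and let `y → 0+` on both sides. In the limit,
endpoints of the interval count with half their mass. -/
lemma integral_boundary_eq (hv : ContinuousOn v {z | 0 ≤ z.im})
    (hμ : ∀ z : ℂ, 0 < z.im → v z = ∫ t, poissonKernel z.im z.re t ∂μ) {c d : ℝ} (hcd : c ≤ d) :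
    Integrable (fun t => (1 + t ^ 2) * (arctanLimit (d - t) - arctanLimit (c - t))) μ ∧
    ∫ x in c..d, v x = ∫ t, (1 + t ^ 2) * (arctanLimit (d - t) - arctanLimit (c - t)) ∂μ := by
  -- Truncating `y` at `0` makes the integrand continuous for all real `y`, so the parametric
  -- integral is continuous at `0`.
  have hcont : Continuous (Function.uncurry fun y x : ℝ =>
      v ((x : ℂ) + ((max y 0 : ℝ) : ℂ) * Complex.I)) := by
    refine hv.comp_continuous (f := fun q : ℝ × ℝ =>
      (q.2 : ℂ) + ((max q.1 0 : ℝ) : ℂ) * Complex.I) (by fun_prop) fun q => ?_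
    simp
  have h1 := ((intervalIntegral.continuous_parametric_intervalIntegral_of_continuous'
    (μ := volume) hcont c d).tendsto 0).mono_left (nhdsWithin_le_nhds (s := Set.Ioi 0))
  simp only [max_self, Complex.ofReal_zero, zero_mul, add_zero] at h1
  obtain ⟨R, hR⟩ := exists_sq_le c d
  set B : ℝ := (1 + 2 * R) * Real.pi + 2 * (d - c)
  have hsmall : ∀ᶠ y : ℝ in 𝓝[>] 0, 0 < y ∧ y ≤ 1 := by
    filter_upwards [Ioc_mem_nhdsGT (zero_lt_one (α := ℝ))] with y hy using hy
  have hbound : ∀ᶠ y : ℝ in 𝓝[>] 0, ∀ᵐ t ∂μ, ‖∫ x in c..d, poissonKernel y x t‖ ≤ B := by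
    filter_upwards [hsmall] with y hy
    refine ae_of_all _ fun t => ?_
    rw [Real.norm_of_nonneg (intervalIntegral.integral_nonneg hcd fun x _ =>
      poissonKernel_nonneg hy.1.le _ _)]
    exact integral_poissonKernel_le hy.1 hy.2 hcd hR t
  have h2 := tendsto_integral_filter_of_dominated_convergence (μ := μ) (l := 𝓝[>] (0 : ℝ))
    (F := fun y t => ∫ x in c..d, poissonKernel y x t) (fun _ => B) (by
      filter_upwards [hsmall] with y hy
      simp only [integral_poissonKernel hy.1]
      exact Measurable.aestronglyMeasurable (by fun_prop)) hbound (integrable_const B)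
    (ae_of_all _ fun t => tendsto_integral_poissonKernel c d t)
  refine ⟨?_, tendsto_nhds_unique h1 (h2.congr' ?_)⟩
  · refine Integrable.of_bound (Measurable.aestronglyMeasurable ?_) B (ae_of_all _ fun t => ?_)
    · have := measurable_arctanLimit
      fun_prop
    · refine le_of_tendsto (tendsto_integral_poissonKernel c d t).norm ?_
      filter_upwards [hsmall] with y hy
      rw [Real.norm_of_nonneg (intervalIntegral.integral_nonneg hcd fun x _ =>
        poissonKernel_nonneg hy.1.le _ _)]
      exact integral_poissonKernel_le hy.1 hy.2 hcd hR t
  · filter_upwards [hsmall] with y hy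
    rw [← integral_integral_poissonKernel μ hy.1 hcd]
    refine intervalIntegral.integral_congr fun x _ => ?_
    simp only [max_eq_left hy.1.le]
    rw [hμ _ (by simpa using hy.1)]
    simp

lemma arctanLimit_sub_nonneg {c d : ℝ} (hcd : c ≤ d) (t : ℝ) :
    0 ≤ arctanLimit (d - t) - arctanLimit (c - t) := by
  have := Real.pi_pos
  unfold arctanLimit
  split_ifs <;> grind

lemma arctanLimit_sub_eq {c d t : ℝ} (hc : t ≠ c) (hd : t ≠ d) (hcd : c ≤ d) :
    arctanLimit (d - t) - arctanLimit (c - t) = (Set.Ioc c d).indicator (fun _ => Real.pi) t := by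
  have hc' := sub_ne_zero.mpr hc.symm
  have hd' := sub_ne_zero.mpr hd.symm
  simp only [arctanLimit, hc', hd', if_false, Set.indicator_apply, Set.mem_Ioc, sub_pos]
  have := hc.lt_or_gt
  have := hd.lt_or_gt
  split_ifs <;> grind

lemma noAtoms_of_inversion (hv : ContinuousOn v {z | 0 ≤ z.im})
    (hμ : ∀ z : ℂ, 0 < z.im → v z = ∫ t, poissonKernel z.im z.re t ∂μ) : NullSingletonClass μ := by
  refine ⟨fun x => ?_⟩
  have hvr : Continuous fun x : ℝ => v x :=
    hv.comp_continuous (by fun_prop) fun x => by simp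
  -- An atom at `x` contributes `π (1 + x²) μ{x} ≥ π μ{x}` to the right side of the inversion
  -- formula on every interval around `x`.
  have key : ∀ δ : ℝ, 0 < δ → μ.real {x} * Real.pi ≤ ∫ s in (x - δ)..(x + δ), v s := by
    intro δ hδ
    obtain ⟨hi, he⟩ := integral_boundary_eq hv hμ (by linarith : x - δ ≤ x + δ)
    rw [he, ← smul_eq_mul, ← setIntegral_const]
    rw [← integral_indicator (measurableSet_singleton x)]
    refine integral_mono_ae ((integrable_const _).indicator (measurableSet_singleton x)) hi
      (ae_of_all _ fun t => ?_)
    have h0 := arctanLimit_sub_nonneg (by linarith : x - δ ≤ x + δ) t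
    by_cases h : t = x
    · subst h
      have e : arctanLimit (t + δ - t) - arctanLimit (t - δ - t) = Real.pi := by
        have h1 : t + δ - t = δ := by ring
        have h2 : t - δ - t = -δ := by ring
        rw [h1, h2]
        simp only [arctanLimit, hδ, if_true, neg_eq_zero, hδ.ne', if_false]
        rw [if_neg (by linarith)]; ring
      simp only [Set.mem_singleton_iff, Set.indicator_of_mem, e]
      nlinarith [Real.pi_pos, mul_nonneg (sq_nonneg t) Real.pi_pos.le]
    · simp only [Set.mem_singleton_iff, h, not_false_eq_true, Set.indicator_of_notMem]
      positivity
  have hlim : Tendsto (fun δ : ℝ => ∫ s in (x - δ)..(x + δ), v s) (𝓝[>] 0) (𝓝 0) := by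
    have hc : Continuous fun δ : ℝ => ∫ s in (x - δ)..(x + δ), v s := by
      have hF := intervalIntegral.continuous_primitive
        (fun a b => hvr.intervalIntegrable (μ := volume) a b) x
      have : (fun δ : ℝ => ∫ s in (x - δ)..(x + δ), v s) =
          fun δ => (∫ s in x..(x + δ), v s) - ∫ s in x..(x - δ), v s := by
        funext δ
        rw [intervalIntegral.integral_interval_sub_left (hvr.intervalIntegrable _ _)
          (hvr.intervalIntegrable _ _)]
      rw [this]
      exact (hF.comp (by fun_prop : Continuous fun δ : ℝ => x + δ)).sub
        (hF.comp (by fun_prop : Continuous fun δ : ℝ => x - δ))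
    have := (hc.tendsto 0).mono_left (nhdsWithin_le_nhds (s := Set.Ioi 0))
    simpa using this
  have h0 : μ.real {x} * Real.pi ≤ 0 := by
    refine ge_of_tendsto hlim ?_
    filter_upwards [self_mem_nhdsWithin] with δ hδ using key δ hδ
  have h1 : μ.real {x} = 0 :=
    le_antisymm (nonpos_of_mul_nonpos_left h0 Real.pi_pos) measureReal_nonneg
  exact (measureReal_eq_zero_iff).mp h1

/-- Stieltjes inversion for a Poisson integral with continuous boundary values. -/
theorem eq_withDensity_of_poisson (hv : ContinuousOn v {z | 0 ≤ z.im})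
    (hμ : ∀ z : ℂ, 0 < z.im → v z = ∫ t, poissonKernel z.im z.re t ∂μ) :
    μ = (volume : Measure ℝ).withDensity
      fun t => ENNReal.ofReal (v t / (Real.pi * (1 + t ^ 2))) := by
  have hvr : Continuous fun x : ℝ => v x :=
    hv.comp_continuous (by fun_prop) fun x => by simp
  have hna := noAtoms_of_inversion hv hμ
  have hpos : ∀ x : ℝ, 0 ≤ v x := fun x => (boundary_nonneg hv hμ x (by simp)).1
  set w : ℝ → ℝ := fun t => Real.pi * (1 + t ^ 2)
  have hw0 : ∀ t, 0 < w t := fun t => mul_pos Real.pi_pos (by positivity)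
  have hwc : Continuous w := by fun_prop
  -- Both measures agree on half-open intervals, the endpoints being `μ`-null; dividing by `w`
  -- afterwards recovers `μ`.
  have main : μ.withDensity (fun t => ENNReal.ofReal (w t)) =
      (volume : Measure ℝ).withDensity fun t => ENNReal.ofReal (v t) := by
    have : IsLocallyFiniteMeasure (μ.withDensity fun t => ENNReal.ofReal (w t)) :=
      IsLocallyFiniteMeasure.withDensity_ofReal hwc
    refine Measure.ext_of_Ioc _ _ fun {c d} hcd => ?_
    obtain ⟨-, he⟩ := integral_boundary_eq hv hμ hcd.le
    rw [withDensity_apply _ measurableSet_Ioc, withDensity_apply _ measurableSet_Ioc]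
    rw [← ofReal_integral_eq_lintegral_ofReal
        ((hwc.continuousOn.integrableOn_Icc).mono_set Set.Ioc_subset_Icc_self)
        (ae_of_all _ fun t => (hw0 t).le),
      ← ofReal_integral_eq_lintegral_ofReal
        ((hvr.continuousOn.integrableOn_Icc).mono_set Set.Ioc_subset_Icc_self)
        (ae_of_all _ hpos), ← intervalIntegral.integral_of_le (f := fun x : ℝ => v x) hcd.le, he,
      ← integral_indicator measurableSet_Ioc]
    congr 1
    refine integral_congr_ae ?_
    have h1 : ∀ᵐ t ∂μ, t ≠ c := by simp [ae_iff]
    have h2 : ∀ᵐ t ∂μ, t ≠ d := by simp [ae_iff]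
    filter_upwards [h1, h2] with t hc hd
    rw [arctanLimit_sub_eq hc hd hcd.le]
    simp only [Set.indicator_apply, w]
    split_ifs <;> ring
  have hm : Measurable fun t => ENNReal.ofReal (w t) := hwc.measurable.ennreal_ofReal
  have h := congrArg (fun ν => ν.withDensity fun t => (ENNReal.ofReal (w t))⁻¹) main
  rw [withDensity_inv_same hm (ae_of_all _ fun t => by simpa using hw0 t)
    (ae_of_all _ fun t => ENNReal.ofReal_ne_top),
    ← withDensity_mul _ hvr.measurable.ennreal_ofReal
      (g := fun t => (ENNReal.ofReal (w t))⁻¹) hm.inv] at h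
  refine h.trans (congrArg _ (funext fun t => ?_))
  simp only [Pi.mul_apply]
  rw [← ENNReal.ofReal_inv_of_pos (hw0 t), ← ENNReal.ofReal_mul (hpos t), div_eq_mul_inv]

end Inversion


/-! ### Geometry of the rotated half-plane -/

section Rotation

variable {ξ : ℂ}

lemma norm_conj_mul_add (hξ : ‖ξ‖ = 1) (z : ℂ) (g : ℝ) :
    ‖(starRingEnd ℂ) ξ * z + g‖ = ‖z + g * ξ‖ := by
  have h : (starRingEnd ℂ) ξ * ξ = 1 := by
    rw [mul_comm, Complex.mul_conj, Complex.normSq_eq_norm_sq, hξ]; simp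
  have : (starRingEnd ℂ) ξ * z + g = (starRingEnd ℂ) ξ * (z + g * ξ) := by
    linear_combination (-(g : ℂ)) * h
  rw [this, norm_mul, RCLike.norm_conj, hξ, one_mul]

lemma im_add_le_norm (hξ : ‖ξ‖ = 1) {z : ℂ} (g : ℝ) :
    z.im + g * ξ.im ≤ ‖(starRingEnd ℂ) ξ * z + g‖ := by
  rw [norm_conj_mul_add hξ]
  simpa using Complex.im_le_norm (z + g * ξ)

/-- `|x + g ξ|² = (x Re ξ + g)² + (x Im ξ)²`. -/
lemma abs_mul_im_le_norm (hξ : ‖ξ‖ = 1) (x g : ℝ) :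
    |x| * ξ.im ≤ ‖(starRingEnd ℂ) ξ * x + g‖ := by
  rw [norm_conj_mul_add hξ]
  have h1 : ξ.re ^ 2 + ξ.im ^ 2 = 1 := by
    have := Complex.normSq_apply ξ
    rw [Complex.normSq_eq_norm_sq, hξ] at this
    nlinarith
  refine le_of_sq_le_sq ?_ (norm_nonneg _)
  rw [← Complex.normSq_eq_norm_sq, mul_pow, sq_abs, Complex.normSq_apply]
  simp
  have : (x + g * ξ.re) * (x + g * ξ.re) + g * ξ.im * (g * ξ.im) =
      x ^ 2 * (ξ.re ^ 2 + ξ.im ^ 2) + 2 * x * g * ξ.re + g ^ 2 * (ξ.re ^ 2 + ξ.im ^ 2) := by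
    rw [h1]; linear_combination g ^ 2 * h1
  rw [this]
  nlinarith [sq_nonneg (x * ξ.re + g), h1]

/-- Otherwise `ξ̄ z = -r` with `r ≥ g > 0`, so `z = -r ξ` would lie strictly below the real axis. -/
lemma conj_mul_add_mem_slitPlane (hξ : ‖ξ‖ = 1) (hi : 0 < ξ.im) {z : ℂ} (hz : 0 ≤ z.im) {g : ℝ}
    (hg : 0 < g) : (starRingEnd ℂ) ξ * z + g ∈ Complex.slitPlane := by
  rw [Complex.mem_slitPlane_iff]
  by_contra! h
  obtain ⟨h1, h2⟩ := h
  simp at h1 h2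
  have h3 : ξ.re ^ 2 + ξ.im ^ 2 = 1 := by
    have := Complex.normSq_apply ξ
    rw [Complex.normSq_eq_norm_sq, hξ] at this
    nlinarith
  have h4 : z.im = ξ.im * (ξ.re * z.re + ξ.im * z.im) := by
    linear_combination (-z.im) * h3 + ξ.re * h2
  have : ξ.im * (ξ.re * z.re + ξ.im * z.im) < 0 := mul_neg_of_pos_of_neg hi (by linarith)
  linarith

end Rotation

/-- Since `s ≤ s ^ e` for `s, e ≤ 1`, the loss `s⁻¹` does not depend on `e`, hence not on the index
`k`. -/
lemma div_rpow_le {s x e : ℝ} (hs : 0 < s) (hs1 : s ≤ 1) (hx : 0 < x) (he1 : e ≤ 1)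
    {r a : ℝ} (he : 0 ≤ e) (ha : 0 ≤ a) (hr : x * s ≤ r) : a / r ^ e ≤ s⁻¹ * (a / x ^ e) := by
  have h1 : s * x ^ e ≤ r ^ e := by
    calc s * x ^ e ≤ s ^ e * x ^ e := by
          gcongr
          simpa using Real.rpow_le_rpow_of_exponent_ge hs hs1 he1
      _ = (x * s) ^ e := by rw [Real.mul_rpow hx.le hs.le, mul_comm]
      _ ≤ r ^ e := by gcongr
  have hxe : 0 < x ^ e := Real.rpow_pos_of_pos hx e
  calc a / r ^ e ≤ a / (s * x ^ e) := by gcongr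
    _ = s⁻¹ * (a / x ^ e) := by field_simp

lemma Coefficients.norm_pTerm (c : Coefficients) {k : ℕ} (ha : 0 < c.a k) (w : ℂ) :
    ‖c.pTerm k w‖ = c.a k / ‖w + c.γ k‖ ^ c.ε k := by
  rw [pTerm, norm_div, norm_mul, Complex.norm_cpow_real, mul_comm Complex.I,
    Complex.norm_exp_ofReal_mul_I, mul_one, Complex.norm_of_nonneg ha.le]

/-! ### Bounds, continuity and decay of `p(ξ̄ z)` -/

section Admissible

variable {c : Coefficients} {θ : ℝ} {ξ : ℂ}

lemma Coefficients.Admissible.ε_le_one (hc : c.Admissible θ) (hθ : θ ≤ Real.pi / 2) {k : ℕ}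
    (hk : 1 ≤ k) : c.ε k ≤ 1 := by
  have := hc.ε_le k hk
  by_contra! h
  nlinarith [Real.pi_pos]

lemma norm_pTerm_le (hc : c.Admissible θ) (hθ : θ ≤ Real.pi / 2) (hξ : ‖ξ‖ = 1) (hi : 0 < ξ.im)
    {z : ℂ} (hz : 0 ≤ z.im) (n : ℕ) :
    ‖c.pTerm (n + 1) ((starRingEnd ℂ) ξ * z)‖ ≤
      ξ.im⁻¹ * (c.a (n + 1) / c.γ (n + 1) ^ c.ε (n + 1)) := by
  have hk : 1 ≤ n + 1 := by omega
  rw [c.norm_pTerm (hc.a_pos _ hk)]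
  refine div_rpow_le hi (hξ ▸ Complex.im_le_norm ξ) (hc.γ_pos _ hk) (hc.ε_le_one hθ hk)
    (hc.ε_pos _ hk).le (hc.a_pos _ hk).le ?_
  exact (le_add_of_nonneg_left hz).trans (im_add_le_norm hξ _)

lemma continuousOn_p_rot (hc : c.Admissible θ) (hθ : θ ≤ Real.pi / 2) (hξ : ‖ξ‖ = 1)
    (hi : 0 < ξ.im) :
    ContinuousOn (fun z : ℂ => c.p ((starRingEnd ℂ) ξ * z)) {z | 0 ≤ z.im} := by
  refine continuousOn_tsum (fun n => ?_) (hc.step_summable.mul_left ξ.im⁻¹)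
    fun n z hz => norm_pTerm_le hc hθ hξ hi hz n
  intro z hz
  have hk : 1 ≤ n + 1 := by omega
  have hs := conj_mul_add_mem_slitPlane hξ hi hz (hc.γ_pos _ hk)
  refine ContinuousAt.continuousWithinAt ?_
  unfold Coefficients.pTerm
  refine ContinuousAt.div continuousAt_const (ContinuousAt.cpow (by fun_prop) continuousAt_const hs)
    ?_
  rw [Complex.cpow_ne_zero_iff]
  exact Or.inl (Complex.slitPlane_ne_zero hs)

lemma tendsto_p_rot (hc : c.Admissible θ) (hθ : θ ≤ Real.pi / 2) (hξ : ‖ξ‖ = 1)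
    (hi : 0 < ξ.im) :
    Tendsto (fun y : ℝ => c.p ((starRingEnd ℂ) ξ * (y * Complex.I))) atTop (𝓝 0) := by
  have h := tendsto_tsum_of_dominated_convergence (𝓕 := (atTop : Filter ℝ))
    (f := fun (y : ℝ) (n : ℕ) => c.pTerm (n + 1) ((starRingEnd ℂ) ξ * (y * Complex.I)))
    (g := fun _ => 0) (hc.step_summable.mul_left ξ.im⁻¹) (fun n => ?_) ?_
  · simpa [Coefficients.p] using h
  · have hk : 1 ≤ n + 1 := by omega
    rw [tendsto_zero_iff_norm_tendsto_zero]
    simp only [c.norm_pTerm (hc.a_pos _ hk)]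
    refine Tendsto.const_div_atTop ((tendsto_rpow_atTop (hc.ε_pos _ hk)).comp ?_) _
    refine tendsto_atTop_mono (fun y => ?_) tendsto_id
    have := im_add_le_norm hξ (z := y * Complex.I) (c.γ (n + 1))
    simp only [Complex.mul_im, Complex.ofReal_re, Complex.I_im, mul_one, Complex.ofReal_im,
      Complex.I_re, mul_zero, add_zero] at this
    have := mul_pos (hc.γ_pos _ hk) hi
    simp only [id]
    linarith
  · filter_upwards [eventually_ge_atTop 0] with y hy n
    exact norm_pTerm_le hc hθ hξ hi (by simpa using hy) n

lemma norm_pTerm_real_le (hc : c.Admissible θ) (hθ : θ ≤ Real.pi / 2) (hξ : ‖ξ‖ = 1)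
    (hi : 0 < ξ.im) (x : ℝ) (n : ℕ) :
    ‖c.pTerm (n + 1) ((starRingEnd ℂ) ξ * x)‖ ≤
      ξ.im⁻¹ * (c.a (n + 1) / max |x| (c.γ (n + 1)) ^ c.ε (n + 1)) := by
  have hk : 1 ≤ n + 1 := by omega
  rw [c.norm_pTerm (hc.a_pos _ hk)]
  refine div_rpow_le hi (hξ ▸ Complex.im_le_norm ξ) (lt_max_of_lt_right (hc.γ_pos _ hk))
    (hc.ε_le_one hθ hk) (hc.ε_pos _ hk).le (hc.a_pos _ hk).le ?_
  rw [max_mul_of_nonneg _ _ hi.le]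
  refine max_le (abs_mul_im_le_norm hξ _ _) ?_
  simpa using im_add_le_norm hξ (z := (x : ℂ)) (c.γ (n + 1))

end Admissible

/-! ### The weight integral behind the first moment -/

section WeightedIntegral

variable {g e : ℝ}

lemma integral_div_one_add_sq (g : ℝ) :
    ∫ r in (0 : ℝ)..g, r / (1 + r ^ 2) = Real.log (1 + g ^ 2) / 2 := by
  have h : ∀ r ∈ Set.uIcc 0 g, HasDerivAt (fun r : ℝ => Real.log (1 + r ^ 2) / 2)
      (r / (1 + r ^ 2)) r := fun r _ => by
    have hp : 1 + r ^ 2 ≠ 0 := by positivity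
    refine ((((hasDerivAt_pow 2 r).const_add 1).log hp).div_const 2).congr_deriv ?_
    field_simp
    simp [mul_comm]
  rw [intervalIntegral.integral_eq_sub_of_hasDerivAt h]
  · simp
  · exact (Continuous.div (by fun_prop) (by fun_prop)
      fun r => by positivity).intervalIntegrable _ _

lemma integrable_comp_abs_of_Ioi {f : ℝ → ℝ} (hf : IntegrableOn f (Set.Ioi 0)) :
    Integrable fun t => f |t| := by
  have h1 : IntegrableOn (fun t => f |t|) (Set.Ioi 0) :=
    hf.congr_fun (fun t ht => by rw [abs_of_pos (by exact ht)]) measurableSet_Ioi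
  have h2 : IntegrableOn (fun t => f |t|) (Set.Iic 0) := by
    rw [← Measure.map_neg_eq_self (volume : Measure ℝ)]
    have m : MeasurableEmbedding fun t : ℝ => -t := (Homeomorph.neg ℝ).measurableEmbedding
    rw [m.integrableOn_map_iff]
    simp_rw [Function.comp_def, abs_neg, Set.neg_preimage, Set.neg_Iic, neg_zero]
    exact Iff.mpr integrableOn_Ici_iff_integrableOn_Ioi h1
  rw [← integrableOn_univ, ← Set.Iic_union_Ioi (a := (0 : ℝ))]
  exact h2.union h1

/-- The weight `|t| / ((1 + t²) max(|t|, g)^e)` has an integral with an explicit bound. -/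
lemma lintegral_weight_le (hg : 0 < g) (he : 0 < e) :
    ∫⁻ t : ℝ, ENNReal.ofReal (|t| / (1 + |t| ^ 2) / max |t| g ^ e) ≤
      ENNReal.ofReal (Real.log (1 + g ^ 2) / g ^ e + 2 * (1 / (e * g ^ e))) := by
  set G : ℝ → ℝ := fun r => r / (1 + r ^ 2) / max r g ^ e
  have hge : 0 < g ^ e := Real.rpow_pos_of_pos hg e
  have hG0 : ∀ r, 0 ≤ r → 0 ≤ G r := fun r hr => by
    have : 0 < max r g := lt_max_of_lt_right hg
    positivity
  have hGc : Continuous G := by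
    refine Continuous.div (Continuous.div (by fun_prop) (by fun_prop) fun r => by positivity)
      (Continuous.rpow_const (by fun_prop) fun r => Or.inr he.le) fun r => ?_
    exact (Real.rpow_pos_of_pos (lt_max_of_lt_right hg) _).ne'
  -- Beyond `g` use `r / (1 + r²) ≤ 1 / r`; below `g` the maximum is constant and the integral is an
  -- exact logarithm.
  have hle : ∀ r ∈ Set.Ioi g, G r ≤ r ^ (-1 - e) := fun r hr => by
    have hr' : g < r := hr
    have hr0 : 0 < r := hg.trans hr'
    simp only [G, max_eq_left hr'.le]
    rw [Real.rpow_sub hr0, Real.rpow_neg_one]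
    gcongr
    rw [div_le_iff₀ (by positivity)]
    field_simp
    linarith
  have hpow : IntegrableOn (fun r : ℝ => r ^ (-1 - e)) (Set.Ioi g) :=
    integrableOn_Ioi_rpow_of_lt (by linarith) hg
  have hi2 : IntegrableOn G (Set.Ioi g) := by
    refine Integrable.mono' hpow hGc.aestronglyMeasurable ?_
    filter_upwards [ae_restrict_mem measurableSet_Ioi] with r hr
    rw [Real.norm_of_nonneg (hG0 r (hg.trans hr).le)]
    exact hle r hr
  have hi1 : IntegrableOn G (Set.Ioc 0 g) :=
    hGc.continuousOn.integrableOn_Icc.mono_set Set.Ioc_subset_Icc_self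
  have hi : IntegrableOn G (Set.Ioi 0) := by
    rw [← Set.Ioc_union_Ioi_eq_Ioi hg.le]; exact hi1.union hi2
  have b1 : ∫ r in Set.Ioc 0 g, G r = Real.log (1 + g ^ 2) / 2 / g ^ e := by
    rw [← integral_div_one_add_sq, intervalIntegral.integral_of_le hg.le, ← integral_div]
    refine setIntegral_congr_fun measurableSet_Ioc fun r hr => ?_
    simp only [G, max_eq_right hr.2]
  have b2 : ∫ r in Set.Ioi g, G r ≤ 1 / (e * g ^ e) := by
    refine (setIntegral_mono_on hi2 hpow measurableSet_Ioi hle).trans_eq ?_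
    rw [integral_Ioi_rpow_of_lt (by linarith) hg]
    have : -1 - e + 1 = -e := by ring
    rw [this, Real.rpow_neg hg.le]
    field_simp
  have hiabs : Integrable fun t : ℝ => G |t| := integrable_comp_abs_of_Ioi hi
  have := ofReal_integral_eq_lintegral_ofReal hiabs (ae_of_all _ fun t => hG0 _ (abs_nonneg t))
  rw [← this]
  refine ENNReal.ofReal_le_ofReal ?_
  rw [integral_comp_abs, ← Set.Ioc_union_Ioi_eq_Ioi hg.le,
    setIntegral_union (Set.Ioc_disjoint_Ioi le_rfl) measurableSet_Ioi hi1 hi2, b1]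
  have : Real.log (1 + g ^ 2) / g ^ e = 2 * (Real.log (1 + g ^ 2) / 2 / g ^ e) := by ring
  linarith

end WeightedIntegral

/-! ### The representation kernel and the value of `β` -/

section Represented

variable {f : ℂ → ℂ} {β : ℝ} {μ : Measure ℝ} [IsFiniteMeasure μ]

lemma norm_kernel_le (t : ℝ) {z : ℂ} (hz : 0 < z.im) :
    ‖(1 + (t : ℂ) * z) / ((t : ℂ) - z)‖ ≤ ‖z‖ + (1 + ‖z‖ ^ 2) / z.im := by
  have hne : (t : ℂ) - z ≠ 0 := fun h => by
    have := congrArg Complex.im h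
    simp at this; linarith
  -- Splitting off `z` leaves `t` only in the denominator, so the kernel is bounded in `t` and
  -- integrable against a finite measure.
  have h1 : (1 + (t : ℂ) * z) / ((t : ℂ) - z) = z + (1 + z ^ 2) / ((t : ℂ) - z) := by
    field_simp; ring
  have h2 : z.im ≤ ‖(t : ℂ) - z‖ := by
    have := Complex.abs_im_le_norm ((t : ℂ) - z)
    simp at this
    exact (le_abs_self _).trans this
  rw [h1]
  refine (norm_add_le _ _).trans ?_
  rw [norm_div]
  gcongr
  refine (norm_add_le _ _).trans ?_
  simp

lemma measurable_kernel (z : ℂ) :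
    Measurable fun t : ℝ => (1 + (t : ℂ) * z) / ((t : ℂ) - z) := by
  fun_prop

lemma im_sub_eq_of_isRepresentedBy (h : IsRepresentedBy f β μ) {z : ℂ} (hz : 0 < z.im) :
    (f z - z).im = ∫ t, poissonKernel z.im z.re t ∂μ := by
  have hi : Integrable (fun t : ℝ => (1 + (t : ℂ) * z) / ((t : ℂ) - z)) μ :=
    Integrable.of_bound (measurable_kernel z).aestronglyMeasurable _
      (ae_of_all _ fun t => norm_kernel_le t hz)
  have hI := Complex.imCLM.integral_comp_comm hi
  simp only [Complex.imCLM_apply, im_kernel] at hI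
  rw [hI, h z hz]
  simp

lemma norm_kernel_I_le (t : ℝ) {y : ℝ} (hy : 1 ≤ y) :
    ‖(1 + (t : ℂ) * (y * Complex.I)) / ((t : ℂ) - y * Complex.I)‖ ≤ 1 + |t| := by
  have hy0 : 0 < y := by linarith
  have h2 : y ≤ ‖(t : ℂ) - y * Complex.I‖ := by
    have := Complex.abs_im_le_norm ((t : ℂ) - y * Complex.I)
    simp at this
    exact (le_abs_self _).trans this
  rw [norm_div, div_le_iff₀ (by linarith)]
  calc ‖1 + (t : ℂ) * (y * Complex.I)‖ ≤ 1 + |t| * y := by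
        refine (norm_add_le _ _).trans ?_
        simp [abs_of_pos hy0]
    _ ≤ (1 + |t|) * y := by nlinarith
    _ ≤ _ := by gcongr

lemma tendsto_kernel_I (t : ℝ) :
    Tendsto (fun y : ℝ => (1 + (t : ℂ) * (y * Complex.I)) / ((t : ℂ) - y * Complex.I)) atTop
      (𝓝 (-(t : ℂ))) := by
  have hinv : Tendsto (fun y : ℝ => (((y⁻¹ : ℝ)) : ℂ)) atTop (𝓝 0) := by
    exact (Complex.continuous_ofReal.tendsto' 0 0 Complex.ofReal_zero).comp tendsto_inv_atTop_zero
  have h : Tendsto (fun y : ℝ => (((y⁻¹ : ℝ) : ℂ) + t * Complex.I) /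
      (t * ((y⁻¹ : ℝ) : ℂ) - Complex.I)) atTop
      (𝓝 ((0 + t * Complex.I) / (t * 0 - Complex.I))) :=
    (hinv.add_const _).div ((hinv.const_mul _).sub_const _) (by simp)
  have e : (0 + t * Complex.I) / (t * 0 - Complex.I) = -(t : ℂ) := by
    rw [zero_add, mul_zero, zero_sub, div_neg, mul_div_assoc, div_self Complex.I_ne_zero, mul_one]
  rw [e] at h
  refine h.congr' ?_
  filter_upwards [eventually_gt_atTop 0] with y hy
  have hy' : (y : ℂ) ≠ 0 := by exact_mod_cast hy.ne'
  rw [← mul_div_mul_left _ _ hy']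
  push_cast
  congr 1 <;> field_simp

lemma eq_integral_of_tendsto (h : IsRepresentedBy f β μ)
    (hf : Tendsto (fun y : ℝ => f (y * Complex.I) - y * Complex.I) atTop (𝓝 0))
    (hi : Integrable (fun t : ℝ => |t|) μ) : β = ∫ t : ℝ, t ∂μ := by
  have h1 := tendsto_integral_filter_of_dominated_convergence (μ := μ) (l := (atTop : Filter ℝ))
    (F := fun (y : ℝ) (t : ℝ) => (1 + (t : ℂ) * (y * Complex.I)) / ((t : ℂ) - y * Complex.I))
    (fun t => 1 + |t|)
    (Eventually.of_forall fun y => (measurable_kernel _).aestronglyMeasurable)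
    (by
      filter_upwards [eventually_ge_atTop 1] with y hy
      exact ae_of_all _ fun t => norm_kernel_I_le t hy)
    ((integrable_const _).add hi) (ae_of_all _ tendsto_kernel_I)
  have h2 : Tendsto (fun y : ℝ => f (y * Complex.I) - y * Complex.I) atTop
      (𝓝 ((β : ℂ) + ∫ t : ℝ, -(t : ℂ) ∂μ)) := by
    refine (h1.const_add (β : ℂ)).congr' ?_
    filter_upwards [eventually_gt_atTop 0] with y hy
    rw [h _ (by simpa using hy)]
    ring
  have h3 := tendsto_nhds_unique hf h2
  rw [integral_neg, integral_complex_ofReal] at h3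
  have h4 : (β : ℂ) = ((∫ t : ℝ, t ∂μ : ℝ) : ℂ) := by linear_combination -h3
  exact_mod_cast h4

end Represented

/-! ### The map `f` and the first moment of its boundary density -/

section RotatedMap

variable {a b : ℝ}

lemma norm_rot (a b : ℝ) : ‖rot a b‖ = 1 := by
  rw [rot, mul_comm, Complex.norm_exp_ofReal_mul_I]

lemma rot_im_pos (ha : 0 ≤ a) (hab : a < b) (hb : b ≤ Real.pi) : 0 < (rot a b).im := by
  rw [rot, mul_comm, Complex.exp_ofReal_mul_I_im, opening]
  exact Real.sin_pos_of_pos_of_lt_pi (by linarith) (by linarith)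

lemma Coefficients.f_sub (c : Coefficients) (a b : ℝ) (z : ℂ) :
    c.f a b z - z = rot a b * c.p ((starRingEnd ℂ) (rot a b) * z) := by
  have h : rot a b * (starRingEnd ℂ) (rot a b) = 1 := by
    rw [Complex.mul_conj, Complex.normSq_eq_norm_sq, norm_rot]; simp
  rw [f, F]
  linear_combination z * h

lemma ofReal_im_f_sub_le_tsum {c : Coefficients} {θ : ℝ} (hc : c.Admissible θ) (hθ : θ ≤ Real.pi / 2)
    (hi : 0 < (rot a b).im) (x : ℝ) :
    ENNReal.ofReal (c.f a b x - x).im ≤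
      ∑' n : ℕ, ENNReal.ofReal ((rot a b).im⁻¹ *
        (c.a (n + 1) / max |x| (c.γ (n + 1)) ^ c.ε (n + 1))) := by
  set B : ℕ → ℝ := fun n => (rot a b).im⁻¹ *
    (c.a (n + 1) / max |x| (c.γ (n + 1)) ^ c.ε (n + 1))
  have hB0 : ∀ n, 0 ≤ B n := fun n =>
    (norm_nonneg _).trans (norm_pTerm_real_le hc hθ (norm_rot a b) hi x n)
  have hB : Summable B := by
    refine Summable.of_nonneg_of_le hB0 (fun n => ?_) (hc.step_summable.mul_left (rot a b).im⁻¹)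
    have hk : 1 ≤ n + 1 := by omega
    have := hc.γ_pos _ hk
    have := hc.a_pos _ hk
    have := hc.ε_pos _ hk
    simp only [B]
    gcongr
    exact le_max_right _ _
  rw [← ENNReal.ofReal_tsum_of_nonneg hB0 hB]
  refine ENNReal.ofReal_le_ofReal ?_
  rw [c.f_sub]
  refine (Complex.im_le_norm _).trans ?_
  rw [norm_mul, norm_rot, one_mul]
  exact tsum_of_norm_bounded hB.hasSum
    fun n => norm_pTerm_real_le hc hθ (norm_rot a b) hi x n

/-- Working with extended nonnegative integrals lets sum and integral be exchanged by Tonelli before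
finiteness is known. -/
lemma lintegral_abs_lt_top {c : Coefficients} {θ : ℝ} (hc : c.Admissible θ)
    (hθ : θ ≤ Real.pi / 2) (hi : 0 < (rot a b).im)
    (h1 : Summable fun n : ℕ =>
      c.a (n + 1) * Real.log (1 + c.γ (n + 1) ^ 2) / c.γ (n + 1) ^ c.ε (n + 1))
    (h2 : Summable fun n : ℕ => c.a (n + 1) / (c.ε (n + 1) * c.γ (n + 1) ^ c.ε (n + 1))) :
    ∫⁻ t : ℝ, ENNReal.ofReal ((c.f a b t - t).im / (Real.pi * (1 + t ^ 2))) *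
      ENNReal.ofReal |t| < ⊤ := by
  set s := (rot a b).im
  set C : ℕ → ℝ := fun n => s⁻¹ * c.a (n + 1)
  have hC : ∀ n, 0 ≤ C n := fun n => mul_nonneg (inv_nonneg.mpr hi.le) (hc.a_pos _ (by omega)).le
  set W : ℕ → ℝ → ℝ := fun n t => |t| / (1 + |t| ^ 2) / max |t| (c.γ (n + 1)) ^ c.ε (n + 1)
  have hpt : ∀ t : ℝ, ENNReal.ofReal ((c.f a b t - t).im / (Real.pi * (1 + t ^ 2))) *
      ENNReal.ofReal |t| ≤ ∑' n, ENNReal.ofReal (C n) * ENNReal.ofReal (W n t) := by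
    intro t
    have hq : 0 ≤ |t| / (1 + |t| ^ 2) := by positivity
    calc ENNReal.ofReal ((c.f a b t - t).im / (Real.pi * (1 + t ^ 2))) * ENNReal.ofReal |t|
        = ENNReal.ofReal ((Real.pi⁻¹ * (|t| / (1 + |t| ^ 2))) * (c.f a b t - t).im) := by
          rw [← ENNReal.ofReal_mul' (abs_nonneg t), sq_abs]
          congr 1
          field_simp
      _ ≤ ENNReal.ofReal (|t| / (1 + |t| ^ 2)) * ENNReal.ofReal (c.f a b t - t).im := by
          rw [ENNReal.ofReal_mul (by positivity)]
          gcongr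
          refine mul_le_of_le_one_left hq (inv_le_one_of_one_le₀ ?_)
          linarith [Real.pi_gt_three]
      _ ≤ ENNReal.ofReal (|t| / (1 + |t| ^ 2)) * ∑' n : ℕ, ENNReal.ofReal (s⁻¹ *
            (c.a (n + 1) / max |t| (c.γ (n + 1)) ^ c.ε (n + 1))) := by
          gcongr
          exact ofReal_im_f_sub_le_tsum hc hθ hi t
      _ = ∑' n, ENNReal.ofReal (C n) * ENNReal.ofReal (W n t) := by
          rw [← ENNReal.tsum_mul_left]
          refine tsum_congr fun n => ?_
          rw [← ENNReal.ofReal_mul hq, ← ENNReal.ofReal_mul (hC n)]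
          congr 1
          simp only [C, W]
          ring
  have hWm : ∀ n, Measurable (W n) := fun n => by fun_prop
  calc _ ≤ ∫⁻ t : ℝ, ∑' n, ENNReal.ofReal (C n) * ENNReal.ofReal (W n t) := lintegral_mono hpt
    _ = ∑' n, ∫⁻ t : ℝ, ENNReal.ofReal (C n) * ENNReal.ofReal (W n t) :=
        lintegral_tsum fun n => ((hWm n).ennreal_ofReal.const_mul _).aemeasurable
    _ ≤ ∑' n, ENNReal.ofReal (s⁻¹ * (c.a (n + 1) * Real.log (1 + c.γ (n + 1) ^ 2) /
          c.γ (n + 1) ^ c.ε (n + 1)) + 2 * s⁻¹ *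
          (c.a (n + 1) / (c.ε (n + 1) * c.γ (n + 1) ^ c.ε (n + 1)))) := by
        refine ENNReal.tsum_le_tsum fun n => ?_
        have hk : 1 ≤ n + 1 := by omega
        rw [lintegral_const_mul _ (hWm n).ennreal_ofReal]
        refine (mul_le_mul_right (lintegral_weight_le (hc.γ_pos _ hk) (hc.ε_pos _ hk)) _).trans_eq ?_
        rw [← ENNReal.ofReal_mul (hC n)]
        congr 1
        simp only [C]
        ring
    _ < ⊤ := ((h1.mul_left _).add (h2.mul_left _)).tsum_ofReal_lt_top

end RotatedMap

end SlopeExample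

theorem proposition3p3 (a b : ℝ) (ha : 0 ≤ a) (hab : a < b) (hb : b ≤ Real.pi)
    (hne : ¬ (a = 0 ∧ b = Real.pi))
    (c : SlopeExample.Coefficients) (hc : c.Admissible (SlopeExample.opening a b))
    (β : ℝ) (μ : Measure ℝ) [IsFiniteMeasure μ]
    (hrep : SlopeExample.IsRepresentedBy (c.f a b) β μ) :
    μ ≪ (volume : Measure ℝ) ∧
    (∃ vstar : ℝ → ℝ,
      (∀ x : ℝ, 0 ≤ vstar x ∧
        Tendsto (fun y : ℝ =>
            (c.f a b ((x : ℂ) + (y : ℂ) * Complex.I) - ((x : ℂ) + (y : ℂ) * Complex.I)).im)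
          (𝓝[>] 0) (𝓝 (vstar x))) ∧
      μ = (volume : Measure ℝ).withDensity
        (fun t => ENNReal.ofReal (vstar t / (Real.pi * (1 + t ^ 2))))) ∧
    ((Summable fun n : ℕ =>
          c.a (n + 1) * Real.log (1 + c.γ (n + 1) ^ 2) / c.γ (n + 1) ^ c.ε (n + 1)) →
      (Summable fun n : ℕ => c.a (n + 1) / (c.ε (n + 1) * c.γ (n + 1) ^ c.ε (n + 1))) →
      Integrable (fun t : ℝ => |t|) μ) ∧
    (Integrable (fun t : ℝ => |t|) μ → β = ∫ t : ℝ, t ∂μ) := by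
  have hθ : SlopeExample.opening a b ≤ Real.pi / 2 := by unfold SlopeExample.opening; linarith
  have hξ := SlopeExample.norm_rot a b
  have hi := SlopeExample.rot_im_pos ha hab hb
  have hv : ContinuousOn (fun z : ℂ => (c.f a b z - z).im) {z | 0 ≤ z.im} := by
    simp only [c.f_sub]
    exact Complex.continuous_im.comp_continuousOn
      (continuousOn_const.mul (SlopeExample.continuousOn_p_rot hc hθ hξ hi))
  have hP : ∀ z : ℂ, 0 < z.im → (c.f a b z - z).im =
      ∫ t, SlopeExample.poissonKernel z.im z.re t ∂μ :=
    fun z hz => SlopeExample.im_sub_eq_of_isRepresentedBy hrep hz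
  have hμ := SlopeExample.eq_withDensity_of_poisson hv hP
  -- The formula for `f` still makes sense at real points, so its value there serves as the boundary
  -- value.
  refine ⟨hμ ▸ withDensity_absolutelyContinuous _ _, ⟨fun x => (c.f a b x - x).im, fun x =>
    SlopeExample.boundary_nonneg hv hP x (by simp), hμ⟩, fun h1 h2 => ?_, fun hint => ?_⟩
  · have hvm : Measurable fun t : ℝ => (c.f a b t - t).im :=
      (hv.comp_continuous (by fun_prop) fun x => by simp : Continuous fun t : ℝ => _).measurable
    refine ⟨by fun_prop, ?_⟩
    rw [hasFiniteIntegral_iff_ofReal (ae_of_all _ fun t => abs_nonneg t), hμ,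
      lintegral_withDensity_eq_lintegral_mul _ (by fun_prop) (by fun_prop)]
    exact SlopeExample.lintegral_abs_lt_top hc hθ hi h1 h2
  · refine SlopeExample.eq_integral_of_tendsto hrep ?_ hint
    simp only [c.f_sub]
    simpa using (SlopeExample.tendsto_p_rot hc hθ hξ hi).const_mul (SlopeExample.rot a b)
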